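/- Let $W=\{W(A)\}$ be a space-time Gaussian white noise on a probability space $(\Omega,\mathcal F,P)$: a centered Gaussian family indexed by the Borel sets $A\subset\mathbb R_+\times\mathbb R$ of finite Lebesgue measure $|A|$, with $\mathbb E[W(A)W(B)]=|A\cap B|$. Let $\mathfrak H=L^2(\mathbb R_+\times\mathbb R)$, and let $h\mapsto W(h)$ be the Wiener integral, i.e. the linear isometry $\mathfrak H\to L^2(\Omega)$ with $W(\mathbf 1_A)=W(A)$. For $F=f(W(h_1),\dots,W(h_n))$, where $h_i\in\mathfrak H$ and $f:\mathbb R^n\to\mathbb R$ is smooth and, together with all its partial derivatives, of at most polynomial growth, put $DF=\sum_{i=1}^n\frac{\partial f}{\partial x_i}(W(h_1),\dots,W(h_n))\,h_i$. Let $D:\mathbb D^{1,2}\to L^2(\Omega;\mathfrak H)$ denote the closure of this operator, where $\mathbb D^{1,2}\subset L^2(\Omega)$ is the completion of the set of such $F$ for the norm $(\mathbb E|F|^2+\mathbb E\|DF\|_{\mathfrak H}^2)^{1/2}$. Let $\delta$ (the Skorohod integral) be its adjoint: $v\in L^2(\Omega;\mathfrak H)$ lies in $\mathrm{Dom}\,\delta$,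 with value $\delta(v)\in L^2(\Omega)$, if $\mathbb E[\delta(v)G]=\mathbb E\langle v,DG\rangle_{\mathfrak H}$ for all $G\in\mathbb D^{1,2}$ (where $\delta(v)$ is taken in the $L^2(\Omega)$-closure of $\mathbb D^{1,2}$, which is automatic if $\mathcal F$ is generated by $W$ up to null sets). **Proposition 2.2.** Let $F=\delta(v)$ for some $v\in\mathrm{Dom}\,\delta$, and assume that $F\in\mathbb D^{1,2}$ and $\mathbb E[F^2]=1$. Let $Z\sim\mathcal N(0,1)$. Then $$d_{TV}(F,Z):=\sup_{B\subset\mathbb R\text{ Borel}}|P(F\in B)-P(Z\in B)|\le 2\sqrt{\mathrm{Var}\,\langle DF,v\rangle_{\mathfrak H}},$$ where the variance, which may be infinite, is taken in $[0,\infty]$. -/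

import Mathlib

open MeasureTheory ProbabilityTheory
open scoped ENNReal

/-- The space-time domain `ℝ₊ × ℝ`. -/
abbrev SpaceTime : Type := Set.Ici (0 : ℝ) × ℝ

/-- Lebesgue measure on `ℝ₊ × ℝ`. -/
noncomputable def spaceTimeVolume : Measure SpaceTime :=
  (Measure.comap Subtype.val (volume : Measure ℝ)).prod (volume : Measure ℝ)

/-- The Borel subsets of `ℝ₊ × ℝ` of finite Lebesgue measure. -/
abbrev FiniteBorelSet : Type :=
  {A : Set SpaceTime // MeasurableSet A ∧ spaceTimeVolume A < ∞}

/-- The Hilbert space `𝔥 = L²(ℝ₊ × ℝ)`. -/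
abbrev SpaceTimeL2 : Type := Lp ℝ 2 spaceTimeVolume

/-- `W` is a space-time Gaussian white noise: a centered Gaussian family indexed by the Borel
sets of finite measure, with covariance `E[W(A) W(B)] = |A ∩ B|`. -/
structure IsWhiteNoise {Ω : Type*} [MeasurableSpace Ω] (W : FiniteBorelSet → Ω → ℝ)
    (P : Measure Ω) : Prop where
  gaussian : IsGaussianProcess W P
  centered : ∀ A, ∫ ω, W A ω ∂P = 0
  covariance : ∀ A B, ∫ ω, W A ω * W B ω ∂P = (spaceTimeVolume (A.1 ∩ B.1)).toReal

/-- The indicator function of `A` as an element of `L²(ℝ₊ × ℝ)`. -/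
noncomputable def indicatorL2 (A : FiniteBorelSet) : SpaceTimeL2 :=
  indicatorConstLp 2 A.2.1 A.2.2.ne (1 : ℝ)

theorem IsWhiteNoise.memLp {Ω : Type*} [MeasurableSpace Ω] {W : FiniteBorelSet → Ω → ℝ}
    {P : Measure Ω} (hW : IsWhiteNoise W P) (A : FiniteBorelSet) : MemLp (W A) 2 P :=
  (hW.gaussian.hasGaussianLaw_eval A).memLp_two

/-- The random variable `W(A)` as an element of `L²(Ω)`. -/
noncomputable def IsWhiteNoise.noiseL2 {Ω : Type*} [MeasurableSpace Ω]
    {W : FiniteBorelSet → Ω → ℝ} {P : Measure Ω} (hW : IsWhiteNoise W P) (A : FiniteBorelSet) :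
    Lp ℝ 2 P :=
  (hW.memLp A).toLp (W A)

/-- The Wiener integral `h ↦ W(h)`, from `L²(ℝ₊ × ℝ)` to `L²(Ω)`: the continuous linear extension
of `∑ cᵢ 1_{Aᵢ} ↦ ∑ cᵢ W(Aᵢ)`. The two theorems `wienerIntegral_indicatorL2` and
`norm_wienerIntegral` below show that it is the linear isometry with `W(1_A) = W(A)`. -/
noncomputable def IsWhiteNoise.wienerIntegral {Ω : Type*} [MeasurableSpace Ω]
    {W : FiniteBorelSet → Ω → ℝ} {P : Measure Ω} (hW : IsWhiteNoise W P) :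
    SpaceTimeL2 →L[ℝ] Lp ℝ 2 P :=
  LinearMap.extendOfNorm (Finsupp.linearCombination ℝ hW.noiseL2)
    (Finsupp.linearCombination ℝ indicatorL2)

theorem denseRange_linearCombination_indicatorL2 :
    DenseRange (Finsupp.linearCombination ℝ indicatorL2) := by
  intro f
  rw [← LinearMap.coe_range, ← Submodule.topologicalClosure_coe]
  refine Lp.induction ENNReal.ofNat_ne_top (motive := fun f => f ∈ (LinearMap.range
    (Finsupp.linearCombination ℝ indicatorL2)).topologicalClosure) ?_ ?_ ?_ f
  · intro c s hs hμs
    apply Submodule.le_topologicalClosure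
    refine ⟨Finsupp.single ⟨s, hs, hμs⟩ c, ?_⟩
    rw [Finsupp.linearCombination_single, Lp.simpleFunc.coe_indicatorConst, indicatorL2]
    simp only [indicatorConstLp]
    rw [← MemLp.toLp_const_smul]
    congr 1
    ext x
    by_cases hx : x ∈ s <;> simp [hx]
  · exact fun f g hf hg _ h1 h2 => Submodule.add_mem _ h1 h2
  · exact Submodule.isClosed_topologicalClosure _

theorem IsWhiteNoise.norm_linearCombination {Ω : Type*} [MeasurableSpace Ω]
    {W : FiniteBorelSet → Ω → ℝ} {P : Measure Ω} (hW : IsWhiteNoise W P)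
    (c : FiniteBorelSet →₀ ℝ) :
    ‖Finsupp.linearCombination ℝ hW.noiseL2 c‖ = ‖Finsupp.linearCombination ℝ indicatorL2 c‖ := by
  have key : ∀ A B, inner ℝ (hW.noiseL2 A) (hW.noiseL2 B)
      = inner ℝ (indicatorL2 A) (indicatorL2 B) := by
    intro A B
    rw [indicatorL2, indicatorL2, L2.real_inner_indicatorConstLp_one_indicatorConstLp_one
      A.2.1 B.2.1 A.2.2.ne B.2.2.ne,
      Measure.real, ← hW.covariance, L2.inner_def]
    refine integral_congr_ae ?_
    filter_upwards [(hW.memLp A).coeFn_toLp, (hW.memLp B).coeFn_toLp] with ω h1 h2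
    simp only [noiseL2, h1, h2, RCLike.inner_apply, conj_trivial]
    ring
  rw [← sq_eq_sq₀ (norm_nonneg _) (norm_nonneg _), ← real_inner_self_eq_norm_sq,
    ← real_inner_self_eq_norm_sq]
  simp only [Finsupp.linearCombination_apply, Finsupp.sum, sum_inner, inner_sum,
    real_inner_smul_left, real_inner_smul_right, key]

/-- `W(1_A) = W(A)`. -/
theorem IsWhiteNoise.wienerIntegral_indicatorL2 {Ω : Type*} [MeasurableSpace Ω]
    {W : FiniteBorelSet → Ω → ℝ} {P : Measure Ω} (hW : IsWhiteNoise W P) (A : FiniteBorelSet) :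
    hW.wienerIntegral (indicatorL2 A) = hW.noiseL2 A := by
  have h := LinearMap.extendOfNorm_eq (f := Finsupp.linearCombination ℝ hW.noiseL2)
    denseRange_linearCombination_indicatorL2
    ⟨1, fun c => by rw [one_mul, hW.norm_linearCombination]⟩ (Finsupp.single A 1)
  simpa [IsWhiteNoise.wienerIntegral] using h

/-- The Wiener integral is an isometry. -/
theorem IsWhiteNoise.norm_wienerIntegral {Ω : Type*} [MeasurableSpace Ω]
    {W : FiniteBorelSet → Ω → ℝ} {P : Measure Ω} (hW : IsWhiteNoise W P) (h : SpaceTimeL2) :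
    ‖hW.wienerIntegral h‖ = ‖h‖ := by
  refine denseRange_linearCombination_indicatorL2.induction_on h
    (isClosed_eq (by fun_prop) (by fun_prop)) fun c => ?_
  rw [IsWhiteNoise.wienerIntegral, LinearMap.extendOfNorm_eq
    denseRange_linearCombination_indicatorL2
    ⟨1, fun c => by rw [one_mul, hW.norm_linearCombination]⟩, hW.norm_linearCombination]

section Malliavin

variable {Ω H : Type*} [MeasurableSpace Ω] {P : Measure Ω}
  [NormedAddCommGroup H] [InnerProductSpace ℝ H]

/-- The pairs `(F, DF)` of a simple random variable `F = f(W(h₁), …, W(hₙ))`, with `f` smooth and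
of polynomial growth together with all its partial derivatives, and its derivative
`DF = ∑ᵢ (∂f/∂xᵢ)(W(h₁), …, W(hₙ)) hᵢ`; here `I h` is the random variable `W(h)`. -/
def simpleDerivGraph (I : H →L[ℝ] Lp ℝ 2 P) : Set (Lp ℝ 2 P × Lp H 2 P) :=
  {p | ∃ (n : ℕ) (f : (Fin n → ℝ) → ℝ) (h : Fin n → H),
    f.HasTemperateGrowth ∧
    (∀ᵐ ω ∂P, p.1 ω = f (fun j => I (h j) ω)) ∧
    (∀ᵐ ω ∂P, p.2 ω = ∑ i, fderiv ℝ f (fun j => I (h j) ω) (Pi.single i 1) • h i)}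

/-- `F` belongs to `𝔻^{1,2}` and `DF` is its Malliavin derivative. The graph of `D` on `𝔻^{1,2}` is
the closure in `L²(Ω) × L²(Ω; H)` of the graph of `D` on the simple random variables, since
`𝔻^{1,2}` is their completion in the graph norm `(E|F|² + E‖DF‖²)^{1/2}`. -/
def IsMalliavinDeriv (I : H →L[ℝ] Lp ℝ 2 P) (F : Lp ℝ 2 P) (DF : Lp H 2 P) : Prop :=
  (F, DF) ∈ closure (simpleDerivGraph I)

/-- `v` belongs to `Dom δ` and `X = δ(v)`, where `δ` is the adjoint of `D`:
`E[δ(v) G] = E⟨v, DG⟩` for all `G ∈ 𝔻^{1,2}`. As `𝔻^{1,2}` need not be dense in `L²(Ω)` when the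
σ-algebra of `Ω` is larger than the one generated by the noise, `δ(v)` is normalized to lie in the
`L²`-closure of `𝔻^{1,2}`, which makes it unique. -/
structure IsSkorohodIntegral (I : H →L[ℝ] Lp ℝ 2 P) (v : Lp H 2 P) (X : Lp ℝ 2 P) : Prop where
  duality : ∀ (G : Lp ℝ 2 P) (DG : Lp H 2 P), IsMalliavinDeriv I G DG →
    ∫ ω, X ω * G ω ∂P = ∫ ω, inner ℝ (v ω) (DG ω) ∂P
  mem_closure : X ∈ closure {G : Lp ℝ 2 P | ∃ DG : Lp H 2 P, IsMalliavinDeriv I G DG}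

end Malliavin

/-- The total variation distance `sup_B |P(F ∈ B) - Q(G ∈ B)|` over the Borel sets `B ⊆ ℝ` between
(the laws of) two real random variables, which may live on different probability spaces. -/
noncomputable def tvDist {Ω Ω' : Type*} [MeasurableSpace Ω] [MeasurableSpace Ω']
    (F : Ω → ℝ) (P : Measure Ω) (G : Ω' → ℝ) (Q : Measure Ω') : ℝ :=
  ⨆ B : {B : Set ℝ // MeasurableSet B}, |P.real (F ⁻¹' B.1) - Q.real (G ⁻¹' B.1)|

section Stein

open Filter Topology Set
open scoped ContDiff

theorem hasDerivAt_gaussian_weight (x : ℝ) :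
    HasDerivAt (fun y : ℝ => Real.exp (-y ^ 2 / 2)) (-(x * Real.exp (-x ^ 2 / 2))) x := by
  have h : HasDerivAt (fun y : ℝ => -y ^ 2 / 2) (-x) x := by
    have := ((hasDerivAt_pow 2 x).neg).div_const 2
    convert! this using 1
    simp
    ring
  convert! h.exp using 1
  ring

theorem integrable_gaussian_weight : Integrable fun y : ℝ => Real.exp (-y ^ 2 / 2) := by
  have := integrable_exp_neg_mul_sq (b := 1 / 2) (by norm_num)
  refine this.congr (.of_forall fun y => ?_)
  simp only
  congr 1
  ring

theorem integrable_mul_gaussian_weight :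
    Integrable fun y : ℝ => y * Real.exp (-y ^ 2 / 2) := by
  have := integrable_mul_exp_neg_mul_sq (b := 1 / 2) (by norm_num)
  refine this.congr (.of_forall fun y => ?_)
  simp only
  congr 2
  ring

theorem tendsto_gaussian_weight_atTop :
    Tendsto (fun y : ℝ => Real.exp (-y ^ 2 / 2)) atTop (𝓝 0) := by
  refine Real.tendsto_exp_atBot.comp ?_
  have : Tendsto (fun y : ℝ => y ^ 2 / 2) atTop atTop :=
    (tendsto_pow_atTop two_ne_zero).atTop_div_const two_pos
  refine (tendsto_neg_atTop_atBot.comp this).congr fun y => ?_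
  simp [neg_div]

/-- Mills' inequality. -/
theorem mul_integral_Ioi_gaussian_weight_le (x : ℝ) :
    x * ∫ y in Ioi x, Real.exp (-y ^ 2 / 2) ≤ Real.exp (-x ^ 2 / 2) := by
  have h : ∫ y in Ioi x, y * Real.exp (-y ^ 2 / 2) = Real.exp (-x ^ 2 / 2) := by
    have := integral_Ioi_of_hasDerivAt_of_tendsto' (a := x)
      (f := fun y => -Real.exp (-y ^ 2 / 2)) (f' := fun y => y * Real.exp (-y ^ 2 / 2)) (m := 0)
      (fun y _ => by convert! (hasDerivAt_gaussian_weight y).neg using 1; simp)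
      integrable_mul_gaussian_weight.integrableOn
      (by simpa using tendsto_gaussian_weight_atTop.neg)
    simpa using this
  rw [← h, ← integral_const_mul]
  refine setIntegral_mono_on (integrable_gaussian_weight.integrableOn.const_mul x)
    integrable_mul_gaussian_weight.integrableOn measurableSet_Ioi fun y hy => ?_
  have : x ≤ y := (mem_Ioi.1 hy).le
  gcongr

/-- The solution `φ` of Stein's equation `φ'(x) - x φ(x) = g(x)` that vanishes at infinity, when
`g` has mean zero under the standard Gaussian law. -/
noncomputable def steinSolution (g : ℝ → ℝ) (x : ℝ) : ℝ :=
  Real.exp (x ^ 2 / 2) * ∫ y in Iic x, g y * Real.exp (-y ^ 2 / 2)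

theorem integrable_mul_weight_of_bounded {g : ℝ → ℝ} (hg : Continuous g)
    (hb : ∀ x, |g x| ≤ 1) : Integrable fun y => g y * Real.exp (-y ^ 2 / 2) :=
  integrable_gaussian_weight.bdd_mul hg.aestronglyMeasurable
    (.of_forall fun x => by simpa using hb x)

theorem hasDerivAt_steinSolution {g : ℝ → ℝ} (hg : Continuous g) (hb : ∀ x, |g x| ≤ 1) (x : ℝ) :
    HasDerivAt (steinSolution g) (x * steinSolution g x + g x) x := by
  have hi := integrable_mul_weight_of_bounded hg hb
  have hc : Continuous fun y => g y * Real.exp (-y ^ 2 / 2) := by fun_prop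
  have h1 : HasDerivAt (fun x => ∫ y in Iic x, g y * Real.exp (-y ^ 2 / 2))
      (g x * Real.exp (-x ^ 2 / 2)) x := by
    have h2 := (intervalIntegral.integral_hasDerivAt_right (a := 0) (b := x)
      (hi.intervalIntegrable) (hc.stronglyMeasurableAtFilter _ _) hc.continuousAt).const_add
        (∫ y in Iic 0, g y * Real.exp (-y ^ 2 / 2))
    refine h2.congr_of_eventuallyEq (.of_forall fun z => ?_)
    simp only
    rw [← intervalIntegral.integral_Iic_sub_Iic hi.integrableOn hi.integrableOn]
    ring
  have h3 : HasDerivAt (fun y : ℝ => Real.exp (y ^ 2 / 2)) (x * Real.exp (x ^ 2 / 2)) x := by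
    have h : HasDerivAt (fun y : ℝ => y ^ 2 / 2) x x := by
      have := (hasDerivAt_pow 2 x).div_const 2
      convert! this using 1
      simp
    convert! h.exp using 1
    ring
  convert! h3.mul h1 using 1
  have : Real.exp (x ^ 2 / 2) * Real.exp (-x ^ 2 / 2) = 1 := by
    rw [← Real.exp_add]
    ring_nf
    simp
  simp only [steinSolution]
  linear_combination -(g x) * this

theorem abs_setIntegral_mul_weight_le {g : ℝ → ℝ} (hg : Continuous g) (hb : ∀ x, |g x| ≤ 1)
    (s : Set ℝ) :
    |∫ y in s, g y * Real.exp (-y ^ 2 / 2)| ≤ ∫ y in s, Real.exp (-y ^ 2 / 2) := by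
  rw [← Real.norm_eq_abs]
  refine (norm_integral_le_integral_norm _).trans (integral_mono
    (integrable_mul_weight_of_bounded hg hb).norm.integrableOn
    integrable_gaussian_weight.integrableOn fun y => ?_)
  simp only [norm_mul, Real.norm_eq_abs, Real.abs_exp]
  exact mul_le_of_le_one_left (Real.exp_pos _).le (hb y)

theorem abs_mul_steinSolution_le {g : ℝ → ℝ} (hg : Continuous g) (hb : ∀ x, |g x| ≤ 1)
    (h0 : ∫ y, g y * Real.exp (-y ^ 2 / 2) = 0) (x : ℝ) : |x * steinSolution g x| ≤ 1 := by
  have hi := integrable_mul_weight_of_bounded hg hb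
  have key : |x| * |∫ y in Iic x, g y * Real.exp (-y ^ 2 / 2)| ≤ Real.exp (-x ^ 2 / 2) := by
    rcases le_total 0 x with hx | hx
    · have h1 : ∫ y in Iic x, g y * Real.exp (-y ^ 2 / 2)
          = -∫ y in Ioi x, g y * Real.exp (-y ^ 2 / 2) := by
        have := intervalIntegral.integral_Iic_add_Ioi (b := x) hi.integrableOn hi.integrableOn
        linarith
      rw [h1, abs_neg, abs_of_nonneg hx]
      exact (mul_le_mul_of_nonneg_left (abs_setIntegral_mul_weight_le hg hb _) hx).trans
        (mul_integral_Ioi_gaussian_weight_le x)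
    · have h1 := mul_integral_Ioi_gaussian_weight_le (-x)
      rw [← integral_comp_neg_Iic] at h1
      rw [abs_of_nonpos hx]
      simp only [even_two.neg_pow] at h1
      exact (mul_le_mul_of_nonneg_left (abs_setIntegral_mul_weight_le hg hb _)
        (neg_nonneg.2 hx)).trans h1
  rw [steinSolution, abs_mul, abs_mul, Real.abs_exp]
  calc |x| * (Real.exp (x ^ 2 / 2) * |∫ y in Iic x, g y * Real.exp (-y ^ 2 / 2)|)
      = Real.exp (x ^ 2 / 2) * (|x| * |∫ y in Iic x, g y * Real.exp (-y ^ 2 / 2)|) := by ring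
    _ ≤ Real.exp (x ^ 2 / 2) * Real.exp (-x ^ 2 / 2) := by gcongr
    _ = 1 := by
      rw [← Real.exp_add]
      ring_nf
      simp

theorem iteratedDeriv_succ_of_deriv_eq {φ g : ℝ → ℝ} (hφ : ContDiff ℝ ∞ φ) (hg : ContDiff ℝ ∞ g)
    (h : ∀ x, HasDerivAt φ (x * φ x + g x) x) (n : ℕ) (x : ℝ) :
    iteratedDeriv (n + 1) φ x =
      x * iteratedDeriv n φ x + n * iteratedDeriv (n - 1) φ x + iteratedDeriv n g x := by
  have hd : ∀ {f : ℝ → ℝ}, ContDiff ℝ ∞ f → ∀ k x,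
      HasDerivAt (iteratedDeriv k f) (iteratedDeriv (k + 1) f x) x := fun {f} hf k x => by
    rw [iteratedDeriv_succ]
    exact ((hf.differentiable_iteratedDeriv k (mod_cast WithTop.coe_lt_top _)) x).hasDerivAt
  induction n generalizing x with
  | zero => simpa using (h x).deriv
  | succ n ih =>
    have h1 := (((hasDerivAt_id' x).mul (hd hφ n x)).add
      ((hd hφ (n - 1) x).const_mul (n : ℝ))).add (hd hg n x)
    have h2 : iteratedDeriv (n + 1 + 1) φ x = 1 * iteratedDeriv n φ x + x * iteratedDeriv (n + 1) φ x
        + n * iteratedDeriv (n - 1 + 1) φ x + iteratedDeriv (n + 1) g x := by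
      rw [iteratedDeriv_succ, ← h1.deriv]
      exact congrArg (deriv · x) (funext ih)
    rw [h2]
    rcases n with _ | n
    · simp
      ring
    · simp only [Nat.add_sub_cancel]
      push_cast
      ring

theorem contDiff_of_deriv_eq {φ g : ℝ → ℝ} (hg : ContDiff ℝ ∞ g)
    (h : ∀ x, HasDerivAt φ (x * φ x + g x) x) : ContDiff ℝ ∞ φ := by
  have hd : deriv φ = fun x => x * φ x + g x := funext fun x => (h x).deriv
  refine contDiff_infty.2 fun n => ?_
  induction n with
  | zero => exact contDiff_zero.2 (continuous_iff_continuousAt.2 fun x => (h x).continuousAt)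
  | succ n ih =>
    have := (contDiff_succ_iff_deriv (n := n) (f := φ) (𝕜 := ℝ)).2
      ⟨fun x => (h x).differentiableAt, by simp,
        by rw [hd]; exact (contDiff_id.mul ih).add (hg.of_le (mod_cast le_top))⟩
    exact_mod_cast this

theorem hasTemperateGrowth_of_deriv_eq {φ g : ℝ → ℝ} (hg : g.HasTemperateGrowth)
    (h : ∀ x, HasDerivAt φ (x * φ x + g x) x) {k₀ : ℕ} {C₀ : ℝ}
    (hb : ∀ x, ‖φ x‖ ≤ C₀ * (1 + ‖x‖) ^ k₀) : φ.HasTemperateGrowth := by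
  have hφ := contDiff_of_deriv_eq hg.1 h
  refine ⟨hφ, fun n => ?_⟩
  simp only [norm_iteratedFDeriv_eq_norm_iteratedDeriv]
  induction n using Nat.strong_induction_on with
  | _ n ih =>
    rcases n with _ | n
    · exact ⟨k₀, C₀, by simpa using hb⟩
    obtain ⟨k₁, C₁, h₁⟩ := ih n (by omega)
    obtain ⟨k₂, C₂, h₂⟩ := ih (n - 1) (by omega)
    obtain ⟨k₃, C₃, h₃⟩ := hg.2 n
    simp only [norm_iteratedFDeriv_eq_norm_iteratedDeriv] at h₃
    refine ⟨1 + k₁ + k₂ + k₃, |C₁| + n * |C₂| + |C₃|, fun x => ?_⟩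
    have h1 : 1 ≤ 1 + ‖x‖ := by simp
    have hp : ∀ {C : ℝ} {j : ℕ}, j ≤ 1 + k₁ + k₂ + k₃ →
        C * (1 + ‖x‖) ^ j ≤ |C| * (1 + ‖x‖) ^ (1 + k₁ + k₂ + k₃) := fun {C j} hj =>
      mul_le_mul (le_abs_self C) (pow_le_pow_right₀ h1 hj) (by positivity) (abs_nonneg C)
    have hx : ‖x‖ * ‖iteratedDeriv n φ x‖ ≤ |C₁| * (1 + ‖x‖) ^ (1 + k₁ + k₂ + k₃) := by
      calc ‖x‖ * ‖iteratedDeriv n φ x‖ ≤ (1 + ‖x‖) * (C₁ * (1 + ‖x‖) ^ k₁) :=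
            mul_le_mul (by simp) (h₁ x) (norm_nonneg _) (by positivity)
        _ = C₁ * (1 + ‖x‖) ^ (1 + k₁) := by ring
        _ ≤ _ := hp (by omega)
    rw [iteratedDeriv_succ_of_deriv_eq hφ hg.1 h]
    calc ‖x * iteratedDeriv n φ x + n * iteratedDeriv (n - 1) φ x + iteratedDeriv n g x‖
        ≤ ‖x‖ * ‖iteratedDeriv n φ x‖ + n * ‖iteratedDeriv (n - 1) φ x‖
          + ‖iteratedDeriv n g x‖ := by
          refine (norm_add₃_le).trans ?_
          simp
      _ ≤ |C₁| * (1 + ‖x‖) ^ (1 + k₁ + k₂ + k₃) + n * (|C₂| * (1 + ‖x‖) ^ (1 + k₁ + k₂ + k₃))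
          + |C₃| * (1 + ‖x‖) ^ (1 + k₁ + k₂ + k₃) := by
          gcongr
          · exact (h₂ x).trans (hp (by omega))
          · exact (h₃ x).trans (hp (by omega))
      _ = _ := by ring

/-- A smooth solution of Stein's equation with derivative bounded by `2`. -/
theorem exists_stein_solution {g : ℝ → ℝ} (hg : g.HasTemperateGrowth)
    (hb : ∀ x, g x ∈ Icc (0 : ℝ) 1) :
    ∃ φ : ℝ → ℝ, φ.HasTemperateGrowth ∧ (∀ x, |deriv φ x| ≤ 2) ∧
      ∀ x, deriv φ x = x * φ x + (g x - ∫ y, g y ∂gaussianReal 0 1) := by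
  set c := ∫ y, g y ∂gaussianReal 0 1 with hc_def
  have hgc : Continuous g := hg.1.continuous
  have hgi : Integrable g (gaussianReal 0 1) :=
    .of_bound hgc.aestronglyMeasurable 1 (.of_forall fun x => by
      rw [Real.norm_eq_abs, abs_of_nonneg (hb x).1]; exact (hb x).2)
  have hc0 : 0 ≤ c := integral_nonneg fun x => (hb x).1
  have hc1 : c ≤ 1 := by
    have := integral_mono hgi (integrable_const (1 : ℝ)) fun x => (hb x).2
    simpa using this
  have hb' : ∀ x, |g x - c| ≤ 1 := fun x => by
    rw [abs_le]
    constructor <;> linarith [(hb x).1, (hb x).2]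
  have hcont : Continuous fun x => g x - c := by fun_prop
  have h0 : ∫ y, (g y - c) * Real.exp (-y ^ 2 / 2) = 0 := by
    have h1 : ∫ y, (g y - c) ∂gaussianReal 0 1 = 0 := by
      rw [integral_sub hgi (integrable_const c)]
      simp [hc_def]
    rw [integral_gaussianReal_eq_integral_smul one_ne_zero] at h1
    have h2 : ∀ y : ℝ, gaussianPDFReal 0 1 y • (g y - c)
        = (√(2 * Real.pi))⁻¹ * ((g y - c) * Real.exp (-y ^ 2 / 2)) := fun y => by
      simp only [gaussianPDFReal, NNReal.coe_one, mul_one, sub_zero, smul_eq_mul]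
      ring
    simp only [h2, integral_const_mul] at h1
    exact (mul_eq_zero.1 h1).resolve_left (by positivity)
  have hd := hasDerivAt_steinSolution hcont hb'
  have hd2 : ∀ x, |deriv (steinSolution fun x => g x - c) x| ≤ 2 := fun x => by
    rw [(hd x).deriv]
    refine (abs_add_le _ _).trans ?_
    linarith [hb' x, abs_mul_steinSolution_le hcont hb' h0 x]
  refine ⟨steinSolution fun x => g x - c, ?_, hd2, fun x => (hd x).deriv⟩
  have hlip : ∀ x, ‖steinSolution (fun x => g x - c) x‖
      ≤ (|steinSolution (fun x => g x - c) 0| + 2) * (1 + ‖x‖) ^ 1 := fun x => by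
    have h1 := convex_univ.norm_image_sub_le_of_norm_deriv_le
      (f := steinSolution fun x => g x - c) (C := 2) (x := 0) (y := x)
      (fun y _ => (hd y).differentiableAt) (fun y _ => hd2 y) (mem_univ _) (mem_univ _)
    simp only [Real.norm_eq_abs, sub_zero, pow_one] at h1 ⊢
    have h2 := abs_sub_abs_le_abs_sub (steinSolution (fun x => g x - c) x)
      (steinSolution (fun x => g x - c) 0)
    nlinarith [abs_nonneg x, abs_nonneg (steinSolution (fun x => g x - c) 0)]
  exact hasTemperateGrowth_of_deriv_eq (hg.sub (.const c)) hd hlip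

end Stein

section ChainRule

open Filter Topology

variable {Ω H : Type*} [MeasurableSpace Ω] {P : Measure Ω}
  [NormedAddCommGroup H] [InnerProductSpace ℝ H]

theorem memLp_comp_of_lipschitzWith [IsFiniteMeasure P] {φ : ℝ → ℝ} {C : NNReal}
    (hφ : LipschitzWith C φ) (F : Lp ℝ 2 P) : MemLp (fun ω => φ (F ω)) 2 P := by
  have h0 : MemLp (fun ω => (C : ℝ) * ‖F ω‖) 2 P := (Lp.memLp F).norm.const_mul _
  have h1 : MemLp (fun ω => |φ 0| + C * ‖F ω‖) 2 P := (memLp_const |φ 0|).add h0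
  refine h1.mono (hφ.continuous.comp_aestronglyMeasurable (Lp.aestronglyMeasurable F))
    (.of_forall fun ω => ?_)
  have h2 := hφ.dist_le_mul (F ω) 0
  rw [Real.dist_eq, Real.dist_eq, sub_zero] at h2
  have h3 := abs_sub_abs_le_abs_sub (φ (F ω)) (φ 0)
  rw [Real.norm_eq_abs, Real.norm_eq_abs, Real.norm_eq_abs]
  exact le_trans (by linarith) (le_abs_self _)

theorem memLp_smul_of_bounded {ψ : ℝ → ℝ} {C : ℝ} (hψ : Continuous ψ) (hb : ∀ x, |ψ x| ≤ C)
    (F : Lp ℝ 2 P) (V : Lp H 2 P) : MemLp (fun ω => ψ (F ω) • V ω) 2 P := by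
  refine (Lp.memLp V).of_le_mul (c := C)
    ((hψ.comp_aestronglyMeasurable (Lp.aestronglyMeasurable F)).smul
      (Lp.aestronglyMeasurable V)) (.of_forall fun ω => ?_)
  rw [norm_smul]
  exact mul_le_mul_of_nonneg_right (hb _) (norm_nonneg _)

/-- The chain rule for simple random variables. -/
theorem simpleDerivGraph_comp {I : H →L[ℝ] Lp ℝ 2 P} {F G : Lp ℝ 2 P} {DF DG : Lp H 2 P}
    (h : (F, DF) ∈ simpleDerivGraph I) {φ : ℝ → ℝ} (hφ : φ.HasTemperateGrowth)
    (hG : G =ᵐ[P] fun ω => φ (F ω)) (hDG : DG =ᵐ[P] fun ω => deriv φ (F ω) • DF ω) :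
    (G, DG) ∈ simpleDerivGraph I := by
  obtain ⟨n, f, e, hf, h1, h2⟩ := h
  refine ⟨n, φ ∘ f, e, hφ.comp hf, ?_, ?_⟩
  · filter_upwards [hG, h1] with ω hω h1
    rw [hω, h1, Function.comp]
  · filter_upwards [hDG, h1, h2] with ω hω h1 h2
    rw [hω, h1, h2, Finset.smul_sum]
    refine Finset.sum_congr rfl fun i _ => ?_
    have hφd : DifferentiableAt ℝ φ (f fun j => I (e j) ω) :=
      (hφ.1.differentiable (by simp)) _
    have hfd : DifferentiableAt ℝ f (fun j => I (e j) ω) := (hf.1.differentiable (by simp)) _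
    rw [fderiv_comp _ hφd hfd, smul_smul]
    congr 1
    simp [mul_comm]

/-- Duality between `δ` and `D` combined with the chain rule `D φ(F) = φ'(F) DF`. -/
theorem IsSkorohodIntegral.integral_mul_comp [IsFiniteMeasure P] {I : H →L[ℝ] Lp ℝ 2 P}
    {v : Lp H 2 P} {X F : Lp ℝ 2 P} {DF : Lp H 2 P} (hX : IsSkorohodIntegral I v X)
    (hF : IsMalliavinDeriv I F DF) {φ : ℝ → ℝ} (hφ : φ.HasTemperateGrowth) {C : NNReal}
    (hC : ∀ x, |deriv φ x| ≤ C) :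
    ∫ ω, X ω * φ (F ω) ∂P = ∫ ω, deriv φ (F ω) * inner ℝ (v ω) (DF ω) ∂P := by
  have hlip : LipschitzWith C φ := lipschitzWith_of_nnnorm_deriv_le
    (hφ.1.differentiable (by simp)) fun x => by exact_mod_cast hC x
  have hdc : Continuous (deriv φ) := hφ.1.continuous_deriv (by simp)
  obtain ⟨p, hp, hlim⟩ := mem_closure_iff_seq_limit.1 hF
  have hlimF : Tendsto (fun n => (p n).1) atTop (𝓝 F) := (continuous_fst.tendsto _).comp hlim
  have hlimD : Tendsto (fun n => (p n).2) atTop (𝓝 DF) := (continuous_snd.tendsto _).comp hlim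
  obtain ⟨ns, hns, hae⟩ := (tendstoInMeasure_of_tendsto_Lp hlimF).exists_seq_tendsto_ae
  have hlimF' := hlimF.comp hns.tendsto_atTop
  have hlimD' := hlimD.comp hns.tendsto_atTop
  have hinner : ∀ V : Lp H 2 P, Integrable (fun ω => inner ℝ (v ω) (V ω)) P := fun V =>
    L2.integrable_inner v V
  have hbdd : ∀ (G : Lp ℝ 2 P) (V : Lp H 2 P),
      Integrable (fun ω => deriv φ (G ω) * inner ℝ (v ω) (V ω)) P := fun G V =>
    (hinner V).bdd_mul (hdc.comp_aestronglyMeasurable (Lp.aestronglyMeasurable G))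
      (.of_forall fun ω => hC _)
  have hsimple : ∀ n, ∫ ω, X ω * φ ((p n).1 ω) ∂P
      = ∫ ω, deriv φ ((p n).1 ω) * inner ℝ (v ω) ((p n).2 ω) ∂P := fun n => by
    have hm1 := memLp_comp_of_lipschitzWith hlip (p n).1
    have hm2 := memLp_smul_of_bounded hdc hC (p n).1 (p n).2
    have := hX.duality (hm1.toLp _) (hm2.toLp _)
      (subset_closure (simpleDerivGraph_comp (hp n) hφ hm1.coeFn_toLp hm2.coeFn_toLp))
    calc ∫ ω, X ω * φ ((p n).1 ω) ∂P = ∫ ω, X ω * hm1.toLp _ ω ∂P := by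
          refine integral_congr_ae ?_
          filter_upwards [hm1.coeFn_toLp] with ω h
          rw [h]
      _ = _ := this
      _ = _ := by
          refine integral_congr_ae ?_
          filter_upwards [hm2.coeFn_toLp] with ω h
          rw [h, real_inner_smul_right]
  have hleft : Tendsto (fun n => ∫ ω, X ω * φ ((p (ns n)).1 ω) ∂P) atTop
      (𝓝 (∫ ω, X ω * φ (F ω) ∂P)) := by
    set L : Lp ℝ 2 P → Lp ℝ 2 P := fun G => (memLp_comp_of_lipschitzWith hlip G).toLp _ with hL
    have hLlim : Tendsto (fun n => L ((p (ns n)).1)) atTop (𝓝 (L F)) := by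
      have hLlip : LipschitzWith C L := LipschitzWith.of_dist_le_mul fun G G' => by
        rw [dist_eq_norm, dist_eq_norm]
        refine Lp.norm_le_mul_norm_of_ae_le_mul ?_
        filter_upwards [Lp.coeFn_sub (L G) (L G'), Lp.coeFn_sub G G',
          (memLp_comp_of_lipschitzWith hlip G).coeFn_toLp,
          (memLp_comp_of_lipschitzWith hlip G').coeFn_toLp] with ω h1 h2 h3 h4
        rw [h1, h2, Pi.sub_apply, Pi.sub_apply, hL]
        simp only
        rw [h3, h4, ← dist_eq_norm, ← dist_eq_norm]
        exact hlip.dist_le_mul _ _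
      exact (hLlip.continuous.tendsto F).comp hlimF'
    have hi : ∀ G : Lp ℝ 2 P, ∫ ω, X ω * φ (G ω) ∂P = inner ℝ X (L G) := fun G => by
      rw [L2.inner_def]
      refine integral_congr_ae ?_
      filter_upwards [(memLp_comp_of_lipschitzWith hlip G).coeFn_toLp] with ω h
      rw [hL]
      simp only
      rw [h]
      simp [mul_comm]
    simp only [hi]
    exact tendsto_const_nhds.inner hLlim
  have hright : Tendsto (fun n => ∫ ω, deriv φ ((p (ns n)).1 ω) *
      inner ℝ (v ω) ((p (ns n)).2 ω) ∂P) atTop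
      (𝓝 (∫ ω, deriv φ (F ω) * inner ℝ (v ω) (DF ω) ∂P)) := by
    have h1 : Tendsto (fun n => ∫ ω, deriv φ ((p (ns n)).1 ω) * inner ℝ (v ω) (DF ω) ∂P) atTop
        (𝓝 (∫ ω, deriv φ (F ω) * inner ℝ (v ω) (DF ω) ∂P)) := by
      refine tendsto_integral_of_dominated_convergence
        (fun ω => C * ‖(inner ℝ (v ω) (DF ω) : ℝ)‖) (fun n => (hbdd _ _).aestronglyMeasurable)
        ((hinner DF).norm.const_mul _) (fun n => .of_forall fun ω => ?_) ?_
      · rw [norm_mul]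
        exact mul_le_mul_of_nonneg_right (hC _) (norm_nonneg _)
      · filter_upwards [hae] with ω hω
        exact ((hdc.tendsto _).comp hω).mul_const _
    have h2 : Tendsto (fun n => ∫ ω, deriv φ ((p (ns n)).1 ω) *
        inner ℝ (v ω) ((p (ns n)).2 ω) ∂P
        - ∫ ω, deriv φ ((p (ns n)).1 ω) * inner ℝ (v ω) (DF ω) ∂P) atTop (𝓝 0) := by
      have h3 : Tendsto (fun n => C * (‖v‖ * ‖(p (ns n)).2 - DF‖)) atTop (𝓝 0) := by
        have := ((tendsto_iff_norm_sub_tendsto_zero.1 hlimD').const_mul ‖v‖).const_mul (C : ℝ)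
        simpa using this
      refine squeeze_zero_norm (fun n => ?_) h3
      set V := (p (ns n)).2
      set G := (p (ns n)).1
      have hm := memLp_smul_of_bounded hdc hC G (V - DF)
      have h4 : ∫ ω, deriv φ (G ω) * inner ℝ (v ω) (V ω) ∂P
          - ∫ ω, deriv φ (G ω) * inner ℝ (v ω) (DF ω) ∂P = inner ℝ v (hm.toLp _) := by
        rw [← integral_sub (hbdd _ _) (hbdd _ _), L2.inner_def]
        refine integral_congr_ae ?_
        filter_upwards [hm.coeFn_toLp, Lp.coeFn_sub V DF] with ω h5 h6
        rw [h5, real_inner_smul_right, h6, Pi.sub_apply, inner_sub_right]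
        ring
      have h7 : ‖hm.toLp _‖ ≤ C * ‖V - DF‖ := by
        refine Lp.norm_le_mul_norm_of_ae_le_mul ?_
        filter_upwards [hm.coeFn_toLp] with ω h5
        rw [h5, norm_smul]
        exact mul_le_mul_of_nonneg_right (hC _) (norm_nonneg _)
      rw [h4]
      calc ‖(inner ℝ v (hm.toLp _) : ℝ)‖ ≤ ‖v‖ * ‖hm.toLp _‖ := norm_inner_le_norm _ _
        _ ≤ ‖v‖ * (C * ‖V - DF‖) := by gcongr
        _ = _ := by ring
    simpa using h2.add h1
  exact tendsto_nhds_unique hleft (by simpa only [hsimple] using hright)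

end ChainRule

section TotalVariation

open Set
open scoped ContDiff

/-- Two finite measures on `ℝ` are `C`-close on all Borel sets if their integrals are `C`-close on
smooth compactly supported functions with values in `[0, 1]`. -/
theorem abs_measureReal_sub_le_of_smooth {μ ν : Measure ℝ} [IsFiniteMeasure μ]
    [IsFiniteMeasure ν] {C : ℝ}
    (h : ∀ g : ℝ → ℝ, ContDiff ℝ ∞ g → HasCompactSupport g → (∀ x, g x ∈ Icc (0 : ℝ) 1) →
      |∫ x, g x ∂μ - ∫ x, g x ∂ν| ≤ C) {B : Set ℝ} (hB : MeasurableSet B) :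
    |μ.real B - ν.real B| ≤ C := by
  refine le_of_forall_pos_le_add fun ε hε => ?_
  have hε' : ENNReal.ofReal (ε / 2) ≠ 0 := by simpa using hε
  obtain ⟨K, hKB, hK, hKlt⟩ := hB.exists_isCompact_sdiff_lt (μ := μ + ν) (measure_ne_top _ _) hε'
  obtain ⟨U, hBU, hU, -, hUlt⟩ := hB.exists_isOpen_sdiff_lt (μ := μ + ν) (measure_ne_top _ _) hε'
  obtain ⟨R, hR⟩ := hK.isBounded.subset_ball 0
  obtain ⟨g, hg, hrange, hg0, hg1⟩ := exists_contMDiff_zero_iff_one_iff_of_isClosed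
    (n := (⊤ : ℕ∞)) (modelWithCornersSelf ℝ ℝ)
    (s := (U ∩ Metric.ball 0 R)ᶜ) (t := K) (hU.inter Metric.isOpen_ball).isClosed_compl hK.isClosed
    (disjoint_compl_left_iff_subset.2 (subset_inter (hKB.trans hBU) hR))
  have hb : ∀ x, g x ∈ Icc (0 : ℝ) 1 := fun x => hrange (mem_range_self x)
  have hsupp : HasCompactSupport g := by
    refine HasCompactSupport.of_support_subset_isCompact (isCompact_closedBall (0 : ℝ) R)
      fun x hx => ?_
    by_contra hxR
    exact hx ((hg0 x).1 fun hxU => hxR (Metric.ball_subset_closedBall hxU.2))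
  have hgc : ContDiff ℝ ∞ g := hg.contDiff
  have hgi : ∀ ρ : Measure ℝ, IsFiniteMeasure ρ → Integrable g ρ := fun ρ _ =>
    hgc.continuous.integrable_of_hasCompactSupport hsupp
  have hdiff : ∀ ρ : Measure ℝ, IsFiniteMeasure ρ →
      |ρ.real B - ∫ x, g x ∂ρ| ≤ ρ.real (U \ K) := fun ρ _ => by
    have hBi : Integrable (B.indicator (1 : ℝ → ℝ)) ρ := (integrable_const (1 : ℝ)).indicator hB
    rw [← integral_indicator_one hB, ← integral_sub hBi (hgi ρ inferInstance),
      ← integral_indicator_one (hU.measurableSet.diff hK.measurableSet), ← Real.norm_eq_abs]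
    refine norm_integral_le_of_norm_le
      ((integrable_const 1).indicator (hU.measurableSet.diff hK.measurableSet))
      (.of_forall fun x => ?_)
    have h0 := (hb x).1
    have h1 := (hb x).2
    by_cases hxK : x ∈ K
    · simp [hxK, hKB hxK, (hg1 x).1 hxK]
    by_cases hxU : x ∈ U
    · simp only [indicator, hxU, hxK, mem_sdiff, not_false_eq_true, and_self, if_true,
        Real.norm_eq_abs, Pi.one_apply]
      rw [abs_le]
      split_ifs <;> constructor <;> linarith
    · have hxB : x ∉ B := fun hx => hxU (hBU hx)
      simp [hxU, hxB, (hg0 x).1 fun hx => hxU hx.1]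
  have hsum : μ.real (U \ K) + ν.real (U \ K) ≤ ε := by
    have hsub : (μ + ν) (U \ K) ≤ ENNReal.ofReal ε := by
      calc (μ + ν) (U \ K) ≤ (μ + ν) ((U \ B) ∪ (B \ K)) := by
            refine measure_mono fun x hx => ?_
            by_cases hxB : x ∈ B
            · exact Or.inr ⟨hxB, hx.2⟩
            · exact Or.inl ⟨hx.1, hxB⟩
        _ ≤ (μ + ν) (U \ B) + (μ + ν) (B \ K) := measure_union_le _ _
        _ ≤ ENNReal.ofReal (ε / 2) + ENNReal.ofReal (ε / 2) := add_le_add hUlt.le hKlt.le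
        _ = ENNReal.ofReal ε := by rw [← ENNReal.ofReal_add (by positivity) (by positivity)]; simp
    have h2 := ENNReal.toReal_le_of_le_ofReal hε.le hsub
    rwa [Measure.add_apply, ENNReal.toReal_add (measure_ne_top _ _) (measure_ne_top _ _)] at h2
  have hμ := abs_le.1 (hdiff μ inferInstance)
  have hν := abs_le.1 (hdiff ν inferInstance)
  have hC := abs_le.1 (h g hgc hsupp hb)
  rw [abs_le]
  constructor <;> linarith [hμ.1, hμ.2, hν.1, hν.2, hC.1, hC.2]

end TotalVariation

/-- The `L¹` norm is at most the `L²` norm on a probability space. -/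
theorem lintegral_enorm_sub_le_evariance_rpow {Ω : Type*} [MeasurableSpace Ω] {P : Measure Ω}
    [IsProbabilityMeasure P] {T : Ω → ℝ} (hT : AEStronglyMeasurable T P) :
    ∫⁻ ω, ‖T ω - P[T]‖ₑ ∂P ≤ (evariance T P) ^ (1 / 2 : ℝ) := by
  have h := eLpNorm_le_eLpNorm_of_exponent_le (μ := P) (p := 1) (q := 2) one_le_two
    (hT.sub (aestronglyMeasurable_const (b := P[T])))
  rw [eLpNorm_one_eq_lintegral_enorm,
    eLpNorm_eq_lintegral_rpow_enorm_toReal two_ne_zero ENNReal.ofNat_ne_top] at h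
  simpa [evariance] using h

section SteinMalliavin

variable {Ω H : Type*} [MeasurableSpace Ω] {P : Measure Ω}
  [NormedAddCommGroup H] [InnerProductSpace ℝ H]

theorem integral_inner_malliavinDeriv_eq_one {I : H →L[ℝ] Lp ℝ 2 P} {v DF : Lp H 2 P}
    {F : Lp ℝ 2 P} (hδ : IsSkorohodIntegral I v F) (hD : IsMalliavinDeriv I F DF)
    (hF : ∫ ω, (F ω) ^ 2 ∂P = 1) : ∫ ω, (inner ℝ (DF ω) (v ω) : ℝ) ∂P = 1 := by
  rw [← hF]
  simp only [sq, hδ.duality F DF hD, real_inner_comm]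

/-- The Malliavin-Stein bound for a smooth test function. -/
theorem ofReal_abs_integral_sub_gaussian_le [IsProbabilityMeasure P] {I : H →L[ℝ] Lp ℝ 2 P}
    {v DF : Lp H 2 P} {F : Lp ℝ 2 P} (hδ : IsSkorohodIntegral I v F) (hD : IsMalliavinDeriv I F DF)
    (hF : ∫ ω, (F ω) ^ 2 ∂P = 1) {g : ℝ → ℝ} (hg : g.HasTemperateGrowth)
    (hb : ∀ x, g x ∈ Set.Icc (0 : ℝ) 1) :
    ENNReal.ofReal |∫ ω, g (F ω) ∂P - ∫ x, g x ∂gaussianReal 0 1| ≤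
      2 * (evariance (fun ω => inner ℝ (DF ω) (v ω)) P) ^ (1 / 2 : ℝ) := by
  obtain ⟨φ, hφ, hφ2, heq⟩ := exists_stein_solution hg hb
  set c := ∫ x, g x ∂gaussianReal 0 1
  have hone := integral_inner_malliavinDeriv_eq_one hδ hD hF
  have hdual := hδ.integral_mul_comp hD hφ (C := 2) (by simpa using hφ2)
  have hlip : LipschitzWith 2 φ := lipschitzWith_of_nnnorm_deriv_le
    (hφ.1.differentiable (by simp)) fun x => by exact_mod_cast hφ2 x
  have hdc : Continuous (deriv φ) := hφ.1.continuous_deriv (by simp)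
  have hmeas : AEStronglyMeasurable (fun ω => deriv φ (F ω)) P :=
    hdc.comp_aestronglyMeasurable (Lp.aestronglyMeasurable F)
  have hTi : Integrable (fun ω => (inner ℝ (v ω) (DF ω) : ℝ)) P := L2.integrable_inner v DF
  have hdi : Integrable (fun ω => deriv φ (F ω)) P :=
    .of_bound hmeas 2 (.of_forall fun ω => hφ2 _)
  have hdTi : Integrable (fun ω => deriv φ (F ω) * inner ℝ (v ω) (DF ω)) P :=
    hTi.bdd_mul hmeas (.of_forall fun ω => hφ2 _)
  have hFφ : Integrable (fun ω => F ω * φ (F ω)) P :=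
    (Lp.memLp F).integrable_mul (memLp_comp_of_lipschitzWith hlip F)
  have hgi : Integrable (fun ω => g (F ω)) P :=
    .of_bound (hg.1.continuous.comp_aestronglyMeasurable (Lp.aestronglyMeasurable F)) 1
      (.of_forall fun ω => by
        rw [Real.norm_eq_abs, abs_of_nonneg (hb _).1]; exact (hb _).2)
  have hkey : ∫ ω, g (F ω) ∂P - c =
      ∫ ω, deriv φ (F ω) * (1 - inner ℝ (DF ω) (v ω)) ∂P := by
    have h1 : ∫ ω, deriv φ (F ω) ∂P = ∫ ω, F ω * φ (F ω) ∂P + (∫ ω, g (F ω) ∂P - c) := by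
      simp only [heq]
      have hgci : Integrable (fun ω => g (F ω) - c) P := hgi.sub (integrable_const c)
      rw [integral_add hFφ hgci, integral_sub hgi (integrable_const c)]
      simp
    simp only [mul_sub, mul_one, real_inner_comm]
    rw [integral_sub hdi hdTi, ← hdual, h1]
    ring
  rw [hkey, ← Real.norm_eq_abs, ofReal_norm]
  calc ‖∫ ω, deriv φ (F ω) * (1 - inner ℝ (DF ω) (v ω)) ∂P‖ₑ
      ≤ ∫⁻ ω, ‖deriv φ (F ω) * (1 - inner ℝ (DF ω) (v ω))‖ₑ ∂P :=
        enorm_integral_le_lintegral_enorm _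
    _ ≤ ∫⁻ ω, 2 * ‖(inner ℝ (DF ω) (v ω) : ℝ) - 1‖ₑ ∂P := by
        refine lintegral_mono fun ω => ?_
        rw [enorm_mul, ← enorm_neg (_ - _), neg_sub]
        gcongr
        rw [← ofReal_norm, Real.norm_eq_abs]
        exact ENNReal.ofReal_le_of_le_toReal (by simpa using hφ2 (F ω))
    _ = 2 * ∫⁻ ω, ‖(inner ℝ (DF ω) (v ω) : ℝ) - 1‖ₑ ∂P :=
        lintegral_const_mul' _ _ ENNReal.ofNat_ne_top
    _ ≤ _ := by
        gcongr
        have h := lintegral_enorm_sub_le_evariance_rpow (P := P)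
          (L2.integrable_inner (𝕜 := ℝ) DF v).aestronglyMeasurable
        rwa [hone] at h

end SteinMalliavin

/-- The variance of `⟨DF, v⟩` is taken in `[0, ∞]`, as `⟨DF, v⟩` is a priori only integrable. -/
theorem proposition2p2 {Ω : Type*} [MeasurableSpace Ω] (P : Measure Ω) [IsProbabilityMeasure P]
    (W : FiniteBorelSet → Ω → ℝ) (hW : IsWhiteNoise W P)
    (v : Lp SpaceTimeL2 2 P) (F : Lp ℝ 2 P) (DF : Lp SpaceTimeL2 2 P)
    (hδ : IsSkorohodIntegral hW.wienerIntegral v F)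
    (hD : IsMalliavinDeriv hW.wienerIntegral F DF)
    (hF : ∫ ω, (F ω) ^ 2 ∂P = 1)
    {Ω' : Type*} [MeasurableSpace Ω'] (P' : Measure Ω') (Z : Ω' → ℝ)
    (hZ : HasLaw Z (gaussianReal 0 1) P') :
    ENNReal.ofReal (tvDist F P Z P') ≤
      2 * (evariance (fun ω => inner ℝ (DF ω) (v ω)) P) ^ (1 / 2 : ℝ) := by
  by_cases htop : 2 * (evariance (fun ω => inner ℝ (DF ω) (v ω)) P) ^ (1 / 2 : ℝ) = ∞
  · rw [htop]
    exact le_top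
  rw [← ENNReal.ofReal_toReal htop]
  refine ENNReal.ofReal_le_ofReal (ciSup_le fun B => ?_)
  have hFm : AEMeasurable F P := (Lp.aestronglyMeasurable F).aemeasurable
  rw [← map_measureReal_apply_of_aemeasurable hFm B.2,
    ← map_measureReal_apply_of_aemeasurable hZ.aemeasurable B.2, hZ.map_eq]
  have : IsProbabilityMeasure (P.map F) := Measure.isProbabilityMeasure_map hFm
  refine abs_measureReal_sub_le_of_smooth (fun g hg hsupp hb => ?_) B.2
  have h := ofReal_abs_integral_sub_gaussian_le hδ hD hF (hsupp.hasTemperateGrowth hg) hb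
  rw [integral_map hFm hg.continuous.aestronglyMeasurable]
  exact (ENNReal.ofReal_le_iff_le_toReal htop).1 h
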